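/- A prop over $\mathrm{Set}$ is a strict symmetric monoidal category with set of objects $\mathbb{N}$ and tensor product given on objects by addition; morphisms of props are strict symmetric monoidal functors that are the identity on objects. For a set $B$, $\mathrm{End}_B$ is the prop with $\mathrm{End}_B(n,m)=\mathrm{Set}(B^n,B^m)$, and an algebra structure on $B$ over a prop $P$ is a morphism of props $r:P\to \mathrm{End}_B$. Let $\mathrm{Boole}$ be the prop over $\mathrm{Set}$ generated by $\cup,\cap:2\to 1$, $c:1\to 1$, $\Delta:1\to 2$, $E,T:0\to 1$ and $ev:1\to 0$ (union, intersection, complement, coproduct, empty element, total element, evaluation), i.e. the quotient of the prop freely generated by these seven morphisms by the congruence (compatible with composition and tensor product) generated by the following relations, where $I$ is the identity of $1$ and $S:2\to2$ is the symmetry: 1. $\cup=\cup\circ S$, $\cap=\cap\circ S$; 2. $\cup\circ(\cup\otimes I)=\cup\circ(I\otimes\cup)$, $\cap\circ(\cap\otimes I)=\cap\circ(I\otimes\cap)$; 3. $\cap\circ(I\otimes\cup)=\cup\circ(\cap\otimes\cap)\circ(I\otimes S\otimes I)\circ(\Delta\otimes I\otimes I)$, $\cup\circ(I\otimes\cap)=\cap\circ(\cup\otimes\cup)\circ(I\otimes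 S\otimes I)\circ(\Delta\otimes I\otimes I)$; 4. $\cup\circ(I\otimes E)=I$, $\cap\circ(I\otimes T)=I$, $\cap\circ(I\otimes c)\circ\Delta=E\circ ev$, $\cup\circ(I\otimes c)\circ\Delta=T\circ ev$; 5. $\cap\circ(I\otimes\cup)\circ(\Delta\otimes I)=I\otimes ev$, $\cup\circ(I\otimes\cap)\circ(\Delta\otimes I)=I\otimes ev$; 6. $(\Delta\otimes I)\circ\Delta=(I\otimes\Delta)\circ\Delta$, $S\circ\Delta=\Delta$. A Boolean monoid structure on a set $B$ consists of maps $\cup,\cap:B\times B\to B$, $c:B\to B$, written $a\mapsto a^c$, and elements $e,t\in B$ such that, for all $x,y,z\in B$: $\cup$ and $\cap$ are commutative and associative, each distributes over the other, $x\cup e=x$, $x\cap t=x$, $x\cup x^c=t$, $x\cap x^c=e$, $x\cup(x\cap y)=x$ and $x\cap(x\cup y)=x$. **Theorem.** Let $B$ be any set. A $\mathrm{Boole}$-algebra structure on $B$ is the same thing as a Boolean monoid structure on $B$. Precisely, sending $r:\mathrm{Boole}\to\mathrm{End}_B$ to the operations $r(\cup),r(\cap),r(c)$ and the elements $r(E),r(T)$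 defines a bijection from the set of $\mathrm{Boole}$-algebra structures on $B$ onto the set of Boolean monoid structures on $B$. Moreover, for every $\mathrm{Boole}$-algebra structure $r$ on $B$ the coproduct is the diagonal, $r(\Delta)(a)=(a,a)$ for all $a\in B$, and $r(ev)$ is the unique map from $B$ to the one-point set $B^0$. -/

import Mathlib

universe u v

/-- Transport of a morphism along equalities of its source and its target. -/
def homCast {H : ℕ → ℕ → Type u} {n n' m m' : ℕ} (hn : n = n') (hm : m = m') (f : H n m) :
    H n' m' :=
  hm ▸ hn ▸ f

theorem homCast_natural {H : ℕ → ℕ → Type u} {K : ℕ → ℕ → Type v}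
    (φ : ∀ n m, H n m → K n m) {n n' m m' : ℕ} (hn : n = n') (hm : m = m') (f : H n m) :
    homCast hn hm (φ n m f) = φ n' m' (homCast hn hm f) := by
  subst hn; subst hm; rfl

/-- A prop over the category of sets: a strict symmetric monoidal category whose objects are
the natural numbers and whose tensor product is addition on objects. Composition is written in
diagrammatic order, and `swap m n` is the symmetry `m + n ⟶ n + m`. -/
structure SetPROP where
  /-- the set of morphisms from `n` to `m` -/
  Hom : ℕ → ℕ → Type u
  id : ∀ n, Hom n n
  comp : ∀ {n m k}, Hom n m → Hom m k → Hom n k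
  tensor : ∀ {n m k l}, Hom n m → Hom k l → Hom (n + k) (m + l)
  swap : ∀ m n, Hom (m + n) (n + m)
  id_comp : ∀ {n m} (f : Hom n m), comp (id n) f = f
  comp_id : ∀ {n m} (f : Hom n m), comp f (id m) = f
  comp_assoc : ∀ {n m k l} (f : Hom n m) (g : Hom m k) (h : Hom k l),
    comp (comp f g) h = comp f (comp g h)
  tensor_id : ∀ n m, tensor (id n) (id m) = id (n + m)
  tensor_comp : ∀ {n m k n' m' k'} (f : Hom n m) (g : Hom m k) (f' : Hom n' m') (g' : Hom m' k'),
    tensor (comp f g) (comp f' g') = comp (tensor f f') (tensor g g')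
  tensor_assoc : ∀ {n m n' m' n'' m''} (f : Hom n m) (g : Hom n' m') (h : Hom n'' m''),
    homCast (Nat.add_assoc n n' n'') (Nat.add_assoc m m' m'') (tensor (tensor f g) h)
      = tensor f (tensor g h)
  id_zero_tensor : ∀ {n m} (f : Hom n m),
    homCast (Nat.zero_add n) (Nat.zero_add m) (tensor (id 0) f) = f
  tensor_id_zero : ∀ {n m} (f : Hom n m),
    homCast (Nat.add_zero n) (Nat.add_zero m) (tensor f (id 0)) = f
  swap_natural : ∀ {n m n' m'} (f : Hom n m) (g : Hom n' m'),
    comp (tensor f g) (swap m m') = comp (swap n n') (tensor g f)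
  swap_swap : ∀ m n, comp (swap m n) (swap n m) = id (m + n)
  hexagon : ∀ m n k,
    swap m (n + k) =
      comp
        (homCast (Nat.add_assoc m n k) (Nat.add_assoc n m k) (tensor (swap m n) (id k)))
        (homCast rfl (Nat.add_assoc n k m).symm (tensor (id n) (swap m k)))

namespace SetPROP

/-- A morphism of props: a strict symmetric monoidal functor which is the identity on objects. -/
@[ext]
structure Morphism (P : SetPROP.{u}) (Q : SetPROP.{v}) where
  map : ∀ {n m}, P.Hom n m → Q.Hom n m
  map_id : ∀ n, map (P.id n) = Q.id n
  map_comp : ∀ {n m k} (f : P.Hom n m) (g : P.Hom m k),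
    map (P.comp f g) = Q.comp (map f) (map g)
  map_tensor : ∀ {n m k l} (f : P.Hom n m) (g : P.Hom k l),
    map (P.tensor f g) = Q.tensor (map f) (map g)
  map_swap : ∀ m n, map (P.swap m n) = Q.swap m n

/-! ### The endomorphism prop of a set -/

theorem homCast_fun {B : Type u} {n n' m m' : ℕ} (hn : n = n') (hm : m = m')
    (f : (Fin n → B) → (Fin m → B)) (x : Fin n → B) :
    homCast (H := fun n m => (Fin n → B) → (Fin m → B)) hn hm f (x ∘ Fin.cast hn.symm)
      = f x ∘ Fin.cast hm.symm := by
  subst hn; subst hm; rfl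

/-- The tensor product `f × g : Bⁿ × Bᵏ → Bᵐ × Bˡ`, where `Bⁿ⁺ᵏ` is identified with `Bⁿ × Bᵏ`
by concatenation. -/
def endTensor {B : Type u} {n m k l : ℕ} (f : (Fin n → B) → (Fin m → B))
    (g : (Fin k → B) → (Fin l → B)) : (Fin (n + k) → B) → (Fin (m + l) → B) :=
  fun x => Fin.append (f fun i => x (Fin.castAdd k i)) (g fun i => x (Fin.natAdd n i))

/-- The exchange of factors `Bᵐ × Bⁿ → Bⁿ × Bᵐ`. -/
def endSwap (B : Type u) (m n : ℕ) : (Fin (m + n) → B) → (Fin (n + m) → B) :=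
  fun x => Fin.append (fun i => x (Fin.natAdd m i)) (fun i => x (Fin.castAdd n i))

theorem endTensor_append {B : Type u} {n m k l : ℕ} (f : (Fin n → B) → (Fin m → B))
    (g : (Fin k → B) → (Fin l → B)) (x : Fin n → B) (y : Fin k → B) :
    endTensor f g (Fin.append x y) = Fin.append (f x) (g y) := by
  simp [endTensor]

theorem endSwap_append {B : Type u} {m n : ℕ} (x : Fin m → B) (y : Fin n → B) :
    endSwap B m n (Fin.append x y) = Fin.append y x := by
  simp [endSwap]

theorem exists_append {B : Type u} {m n : ℕ} (x : Fin (m + n) → B) :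
    ∃ (y : Fin m → B) (z : Fin n → B), x = Fin.append y z :=
  ⟨_, _, (Fin.append_castAdd_natAdd (f := x)).symm⟩

theorem append_assoc_symm {B : Type u} {m n k : ℕ} (x : Fin m → B) (y : Fin n → B)
    (z : Fin k → B) :
    Fin.append x (Fin.append y z)
      = Fin.append (Fin.append x y) z ∘ Fin.cast (Nat.add_assoc m n k).symm := by
  rw [Fin.append_assoc]; rfl

/-- The endomorphism prop of a set `B`: its morphisms from `n` to `m` are all maps
`Bⁿ → Bᵐ`. -/
def endo (B : Type u) : SetPROP.{u} where
  Hom n m := (Fin n → B) → (Fin m → B)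
  id _ := fun x => x
  comp f g := fun x => g (f x)
  tensor f g := endTensor f g
  swap m n := endSwap B m n
  id_comp _ := rfl
  comp_id _ := rfl
  comp_assoc _ _ _ := rfl
  tensor_id n m := by
    funext x
    obtain ⟨y, z, rfl⟩ := exists_append x
    rw [endTensor_append]
  tensor_comp f g f' g' := by
    funext x
    obtain ⟨y, z, rfl⟩ := exists_append x
    simp only [endTensor_append]
  tensor_assoc f g h := by
    funext x
    obtain ⟨a, y, rfl⟩ := exists_append x
    obtain ⟨b, c, rfl⟩ := exists_append y
    rw [endTensor_append, endTensor_append, append_assoc_symm, homCast_fun, endTensor_append,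
      endTensor_append, append_assoc_symm]
  id_zero_tensor {n m} f := by
    funext x
    have hx : x = Fin.append (Fin.elim0 : Fin 0 → B) x ∘ Fin.cast (Nat.zero_add n).symm := by
      rw [Fin.append_left_nil _ _ rfl]; rfl
    conv_lhs => rw [hx]
    rw [homCast_fun, endTensor_append, Fin.append_left_nil _ _ rfl]; rfl
  tensor_id_zero {n m} f := by
    funext x
    have hx : x = Fin.append x (Fin.elim0 : Fin 0 → B) ∘ Fin.cast (Nat.add_zero n).symm := by
      rw [Fin.append_right_nil _ _ rfl]; rfl
    conv_lhs => rw [hx]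
    rw [homCast_fun, endTensor_append, Fin.append_right_nil _ _ rfl]; rfl
  swap_natural f g := by
    funext x
    obtain ⟨y, z, rfl⟩ := exists_append x
    simp only [endTensor_append, endSwap_append]
  swap_swap m n := by
    funext x
    obtain ⟨y, z, rfl⟩ := exists_append x
    simp only [endSwap_append]
  hexagon m n k := by
    funext x
    obtain ⟨a, y, rfl⟩ := exists_append x
    obtain ⟨b, c, rfl⟩ := exists_append y
    rw [endSwap_append, append_assoc_symm a b c, homCast_fun, endTensor_append, endSwap_append,
      ← append_assoc_symm]
    have := homCast_fun rfl (Nat.add_assoc n k m).symm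
      (endTensor (fun x : Fin n → B => x) (endSwap B m k)) (Fin.append b (Fin.append a c))
    rw [endTensor_append, endSwap_append] at this
    refine Eq.trans ?_ this.symm
    rw [Fin.append_assoc]

/-- An algebra structure on the set `B` over the prop `P`: a morphism from `P` to the
endomorphism prop of `B`. -/
abbrev AlgebraOn (P : SetPROP.{u}) (B : Type v) := Morphism P (endo B)

/-! ### The quotient of a prop by the ideal of relations generated by a family of pairs -/

/-- The congruence of props generated by `R`: the smallest family of equivalence relations on the
sets of morphisms which contains `R` and is stable under composition and tensor product. -/
inductive Congr (P : SetPROP.{u}) (R : ∀ n m, P.Hom n m → P.Hom n m → Prop) :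
    ∀ {n m}, P.Hom n m → P.Hom n m → Prop
  | of {n m} {f g : P.Hom n m} : R n m f g → Congr P R f g
  | refl {n m} (f : P.Hom n m) : Congr P R f f
  | symm {n m} {f g : P.Hom n m} : Congr P R f g → Congr P R g f
  | trans {n m} {f g h : P.Hom n m} : Congr P R f g → Congr P R g h → Congr P R f h
  | comp {n m k} {f f' : P.Hom n m} {g g' : P.Hom m k} :
      Congr P R f f' → Congr P R g g' → Congr P R (P.comp f g) (P.comp f' g')
  | tensor {n m k l} {f f' : P.Hom n m} {g g' : P.Hom k l} :
      Congr P R f f' → Congr P R g g' → Congr P R (P.tensor f g) (P.tensor f' g')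

/-- The setoid of the generated congruence on the morphisms from `n` to `m`. -/
def congrSetoid (P : SetPROP.{u}) (R : ∀ n m, P.Hom n m → P.Hom n m → Prop) (n m : ℕ) :
    Setoid (P.Hom n m) :=
  ⟨Congr P R, ⟨Congr.refl, Congr.symm, Congr.trans⟩⟩

/-- The quotient of a prop by the congruence generated by `R`. -/
def quotient (P : SetPROP.{u}) (R : ∀ n m, P.Hom n m → P.Hom n m → Prop) : SetPROP.{u} where
  Hom n m := Quotient (congrSetoid P R n m)
  id n := Quotient.mk _ (P.id n)
  comp := Quotient.map₂ P.comp fun _ _ h _ _ h' => Congr.comp h h'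
  tensor := Quotient.map₂ P.tensor fun _ _ h _ _ h' => Congr.tensor h h'
  swap m n := Quotient.mk _ (P.swap m n)
  id_comp f := by
    induction f using Quotient.inductionOn
    exact congrArg _ (P.id_comp _)
  comp_id f := by
    induction f using Quotient.inductionOn
    exact congrArg _ (P.comp_id _)
  comp_assoc f g h := by
    induction f using Quotient.inductionOn
    induction g using Quotient.inductionOn
    induction h using Quotient.inductionOn
    exact congrArg _ (P.comp_assoc _ _ _)
  tensor_id n m := congrArg _ (P.tensor_id n m)
  tensor_comp f g f' g' := by
    induction f using Quotient.inductionOn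
    induction g using Quotient.inductionOn
    induction f' using Quotient.inductionOn
    induction g' using Quotient.inductionOn
    exact congrArg _ (P.tensor_comp _ _ _ _)
  tensor_assoc f g h := by
    induction f using Quotient.inductionOn
    induction g using Quotient.inductionOn
    induction h using Quotient.inductionOn
    exact (homCast_natural (fun n m => Quotient.mk (congrSetoid P R n m)) _ _ _).trans
      (congrArg _ (P.tensor_assoc _ _ _))
  id_zero_tensor f := by
    induction f using Quotient.inductionOn
    exact (homCast_natural (fun n m => Quotient.mk (congrSetoid P R n m)) _ _ _).trans
      (congrArg _ (P.id_zero_tensor _))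
  tensor_id_zero f := by
    induction f using Quotient.inductionOn
    exact (homCast_natural (fun n m => Quotient.mk (congrSetoid P R n m)) _ _ _).trans
      (congrArg _ (P.tensor_id_zero _))
  swap_natural f g := by
    induction f using Quotient.inductionOn
    induction g using Quotient.inductionOn
    exact congrArg _ (P.swap_natural _ _)
  swap_swap m n := congrArg _ (P.swap_swap m n)
  hexagon m n k := by
    refine (congrArg (Quotient.mk _) (P.hexagon m n k)).trans ?_
    have h₁ := homCast_natural (fun n m => Quotient.mk (congrSetoid P R n m))
      (Nat.add_assoc m n k) (Nat.add_assoc n m k) (P.tensor (P.swap m n) (P.id k))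
    have h₂ := homCast_natural (fun n m => Quotient.mk (congrSetoid P R n m))
      rfl (Nat.add_assoc n k m).symm (P.tensor (P.id n) (P.swap m k))
    exact (congrArg₂ (Quotient.map₂ P.comp fun _ _ h _ _ h' => Congr.comp h h') h₁ h₂).symm

end SetPROP

/-! ### The prop freely generated by a family of vertices -/

/-- Formal composites of vertices; `G n m` is the set of vertices with `n` inputs and
`m` outputs. -/
inductive PropTerm (G : ℕ → ℕ → Type u) : ℕ → ℕ → Type u
  | vertex {n m} : G n m → PropTerm G n m
  | id (n) : PropTerm G n n
  | comp {n m k} : PropTerm G n m → PropTerm G m k → PropTerm G n k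
  | tensor {n m k l} : PropTerm G n m → PropTerm G k l → PropTerm G (n + k) (m + l)
  | swap (m n) : PropTerm G (m + n) (n + m)

namespace PropTerm

/-- Equality of formal composites in the free prop: the smallest congruence which contains all
instances of the axioms of a prop. -/
inductive Rel (G : ℕ → ℕ → Type u) : ∀ {n m}, PropTerm G n m → PropTerm G n m → Prop
  | refl {n m} (f : PropTerm G n m) : Rel G f f
  | symm {n m} {f g : PropTerm G n m} : Rel G f g → Rel G g f
  | trans {n m} {f g h : PropTerm G n m} : Rel G f g → Rel G g h → Rel G f h
  | comp_congr {n m k} {f f' : PropTerm G n m} {g g' : PropTerm G m k} :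
      Rel G f f' → Rel G g g' → Rel G (comp f g) (comp f' g')
  | tensor_congr {n m k l} {f f' : PropTerm G n m} {g g' : PropTerm G k l} :
      Rel G f f' → Rel G g g' → Rel G (tensor f g) (tensor f' g')
  | id_comp {n m} (f : PropTerm G n m) : Rel G (comp (id n) f) f
  | comp_id {n m} (f : PropTerm G n m) : Rel G (comp f (id m)) f
  | comp_assoc {n m k l} (f : PropTerm G n m) (g : PropTerm G m k) (h : PropTerm G k l) :
      Rel G (comp (comp f g) h) (comp f (comp g h))
  | tensor_id (n m) : Rel G (tensor (id n) (id m)) (id (n + m))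
  | tensor_comp {n m k n' m' k'} (f : PropTerm G n m) (g : PropTerm G m k)
      (f' : PropTerm G n' m') (g' : PropTerm G m' k') :
      Rel G (tensor (comp f g) (comp f' g')) (comp (tensor f f') (tensor g g'))
  | tensor_assoc {n m n' m' n'' m''} (f : PropTerm G n m) (g : PropTerm G n' m')
      (h : PropTerm G n'' m'') :
      Rel G (homCast (Nat.add_assoc n n' n'') (Nat.add_assoc m m' m'') (tensor (tensor f g) h))
        (tensor f (tensor g h))
  | id_zero_tensor {n m} (f : PropTerm G n m) :
      Rel G (homCast (Nat.zero_add n) (Nat.zero_add m) (tensor (id 0) f)) f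
  | tensor_id_zero {n m} (f : PropTerm G n m) :
      Rel G (homCast (Nat.add_zero n) (Nat.add_zero m) (tensor f (id 0))) f
  | swap_natural {n m n' m'} (f : PropTerm G n m) (g : PropTerm G n' m') :
      Rel G (comp (tensor f g) (swap m m')) (comp (swap n n') (tensor g f))
  | swap_swap (m n) : Rel G (comp (swap m n) (swap n m)) (id (m + n))
  | hexagon (m n k) :
      Rel G (swap m (n + k))
        (comp
          (homCast (Nat.add_assoc m n k) (Nat.add_assoc n m k) (tensor (swap m n) (id k)))
          (homCast rfl (Nat.add_assoc n k m).symm (tensor (id n) (swap m k))))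

/-- The setoid of equality in the free prop. -/
def setoid (G : ℕ → ℕ → Type u) (n m : ℕ) : Setoid (PropTerm G n m) :=
  ⟨Rel G, ⟨Rel.refl, Rel.symm, Rel.trans⟩⟩

end PropTerm

/-- The prop freely generated by the vertices `G`. -/
def freePROP (G : ℕ → ℕ → Type u) : SetPROP.{u} where
  Hom n m := Quotient (PropTerm.setoid G n m)
  id n := Quotient.mk _ (PropTerm.id n)
  comp := Quotient.map₂ PropTerm.comp fun _ _ h _ _ h' => PropTerm.Rel.comp_congr h h'
  tensor := Quotient.map₂ PropTerm.tensor fun _ _ h _ _ h' => PropTerm.Rel.tensor_congr h h'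
  swap m n := Quotient.mk _ (PropTerm.swap m n)
  id_comp f := by
    induction f using Quotient.inductionOn
    exact Quotient.sound (PropTerm.Rel.id_comp _)
  comp_id f := by
    induction f using Quotient.inductionOn
    exact Quotient.sound (PropTerm.Rel.comp_id _)
  comp_assoc f g h := by
    induction f using Quotient.inductionOn
    induction g using Quotient.inductionOn
    induction h using Quotient.inductionOn
    exact Quotient.sound (PropTerm.Rel.comp_assoc _ _ _)
  tensor_id n m := Quotient.sound (PropTerm.Rel.tensor_id n m)
  tensor_comp f g f' g' := by
    induction f using Quotient.inductionOn
    induction g using Quotient.inductionOn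
    induction f' using Quotient.inductionOn
    induction g' using Quotient.inductionOn
    exact Quotient.sound (PropTerm.Rel.tensor_comp _ _ _ _)
  tensor_assoc f g h := by
    induction f using Quotient.inductionOn
    induction g using Quotient.inductionOn
    induction h using Quotient.inductionOn
    exact (homCast_natural (fun n m => Quotient.mk (PropTerm.setoid G n m)) _ _ _).trans
      (Quotient.sound (PropTerm.Rel.tensor_assoc _ _ _))
  id_zero_tensor f := by
    induction f using Quotient.inductionOn
    exact (homCast_natural (fun n m => Quotient.mk (PropTerm.setoid G n m)) _ _ _).trans
      (Quotient.sound (PropTerm.Rel.id_zero_tensor _))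
  tensor_id_zero f := by
    induction f using Quotient.inductionOn
    exact (homCast_natural (fun n m => Quotient.mk (PropTerm.setoid G n m)) _ _ _).trans
      (Quotient.sound (PropTerm.Rel.tensor_id_zero _))
  swap_natural f g := by
    induction f using Quotient.inductionOn
    induction g using Quotient.inductionOn
    exact Quotient.sound (PropTerm.Rel.swap_natural _ _)
  swap_swap m n := Quotient.sound (PropTerm.Rel.swap_swap m n)
  hexagon m n k := by
    refine (Quotient.sound (PropTerm.Rel.hexagon m n k)).trans ?_
    have h₁ := homCast_natural (fun n m => Quotient.mk (PropTerm.setoid G n m))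
      (Nat.add_assoc m n k) (Nat.add_assoc n m k)
      (PropTerm.tensor (PropTerm.swap m n) (PropTerm.id k))
    have h₂ := homCast_natural (fun n m => Quotient.mk (PropTerm.setoid G n m))
      rfl (Nat.add_assoc n k m).symm (PropTerm.tensor (PropTerm.id n) (PropTerm.swap m k))
    exact (congrArg₂ (Quotient.map₂ PropTerm.comp
      fun _ _ h _ _ h' => PropTerm.Rel.comp_congr h h') h₁ h₂).symm

/-! ### The prop Boole -/

/-- The vertices generating the prop Boole. -/
inductive BooleVertex : ℕ → ℕ → Type
  | union : BooleVertex 2 1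
  | inter : BooleVertex 2 1
  | compl : BooleVertex 1 1
  | coprod : BooleVertex 1 2
  | empty : BooleVertex 0 1
  | total : BooleVertex 0 1
  | eval : BooleVertex 1 0

namespace BooleRel

/-- A generator as a morphism of the free prop. -/
def gen {n m : ℕ} (g : BooleVertex n m) : (freePROP BooleVertex).Hom n m :=
  Quotient.mk _ (PropTerm.vertex g)

/-- The union `2 ⟶ 1`. -/
abbrev U : (freePROP BooleVertex).Hom 2 1 := gen .union

/-- The intersection `2 ⟶ 1`. -/
abbrev N : (freePROP BooleVertex).Hom 2 1 := gen .inter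

/-- The complement `1 ⟶ 1`. -/
abbrev C : (freePROP BooleVertex).Hom 1 1 := gen .compl

/-- The coproduct `1 ⟶ 2`. -/
abbrev D : (freePROP BooleVertex).Hom 1 2 := gen .coprod

/-- The empty element `0 ⟶ 1`. -/
abbrev E : (freePROP BooleVertex).Hom 0 1 := gen .empty

/-- The total element `0 ⟶ 1`. -/
abbrev T : (freePROP BooleVertex).Hom 0 1 := gen .total

/-- The evaluation `1 ⟶ 0`. -/
abbrev ev : (freePROP BooleVertex).Hom 1 0 := gen .eval

/-- The identity `1 ⟶ 1`. -/
abbrev I : (freePROP BooleVertex).Hom 1 1 := (freePROP BooleVertex).id 1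

/-- The symmetry `2 ⟶ 2`. -/
abbrev S : (freePROP BooleVertex).Hom 2 2 := (freePROP BooleVertex).swap 1 1

/-- Composition in diagrammatic order. -/
scoped infixr:65 " ≫ₚ " => SetPROP.comp (freePROP BooleVertex)

/-- Tensor product. -/
scoped infixl:70 " ⊗ₚ " => SetPROP.tensor (freePROP BooleVertex)

/-- The morphism `D ⊗ I`. -/
abbrev DI : (freePROP BooleVertex).Hom 2 3 := D ⊗ₚ I

/-- The morphism `I ⊗ U`. -/
abbrev IU : (freePROP BooleVertex).Hom 3 2 := I ⊗ₚ U

/-- The morphism `I ⊗ N`. -/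
abbrev IN : (freePROP BooleVertex).Hom 3 2 := I ⊗ₚ N

/-- The morphism `D ⊗ I ⊗ I`. -/
abbrev DII : (freePROP BooleVertex).Hom 3 4 := D ⊗ₚ I ⊗ₚ I

/-- The morphism `I ⊗ S ⊗ I`. -/
abbrev ISI : (freePROP BooleVertex).Hom 4 4 := I ⊗ₚ S ⊗ₚ I

/-- The morphism `U ⊗ U`. -/
abbrev UU : (freePROP BooleVertex).Hom 4 2 := U ⊗ₚ U

/-- The morphism `N ⊗ N`. -/
abbrev NN : (freePROP BooleVertex).Hom 4 2 := N ⊗ₚ N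

end BooleRel

open scoped BooleRel in
open BooleRel in
/-- The defining relations of the prop Boole. Composites are written in diagrammatic order. -/
inductive BooleRel : ∀ n m : ℕ, (freePROP BooleVertex).Hom n m →
    (freePROP BooleVertex).Hom n m → Prop
  | union_comm : BooleRel 2 1 U (S ≫ₚ U)
  | inter_comm : BooleRel 2 1 N (S ≫ₚ N)
  | union_assoc : BooleRel 3 1 ((U ⊗ₚ I) ≫ₚ U) (IU ≫ₚ U)
  | inter_assoc : BooleRel 3 1 ((N ⊗ₚ I) ≫ₚ N) (IN ≫ₚ N)
  | inter_union_distrib : BooleRel 3 1 (IU ≫ₚ N)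
      (DII ≫ₚ ISI ≫ₚ NN ≫ₚ U)
  | union_inter_distrib : BooleRel 3 1 (IN ≫ₚ U)
      (DII ≫ₚ ISI ≫ₚ UU ≫ₚ N)
  | union_empty : BooleRel 1 1 ((I ⊗ₚ E) ≫ₚ U) I
  | inter_total : BooleRel 1 1 ((I ⊗ₚ T) ≫ₚ N) I
  | inter_compl : BooleRel 1 1 (D ≫ₚ (I ⊗ₚ C) ≫ₚ N) (ev ≫ₚ E)
  | union_compl : BooleRel 1 1 (D ≫ₚ (I ⊗ₚ C) ≫ₚ U) (ev ≫ₚ T)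
  | inter_absorb : BooleRel 2 1 (DI ≫ₚ IU ≫ₚ N) (I ⊗ₚ ev)
  | union_absorb : BooleRel 2 1 (DI ≫ₚ IN ≫ₚ U) (I ⊗ₚ ev)
  | coassoc : BooleRel 1 3 (D ≫ₚ (D ⊗ₚ I)) (D ≫ₚ (I ⊗ₚ D))
  | cocomm : BooleRel 1 2 (D ≫ₚ S) D

/-- The prop Boole: the quotient of the free prop on the seven vertices by the relations. -/
def Boole : SetPROP.{0} :=
  (freePROP BooleVertex).quotient BooleRel

/-- The class in Boole of a generating vertex. -/
def Boole.gen {n m : ℕ} (g : BooleVertex n m) : Boole.Hom n m :=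
  Quotient.mk _ (BooleRel.gen g)

/-- A Boolean monoid structure on the set `B`. -/
@[ext]
structure BooleanMonoid (B : Type u) where
  union : B → B → B
  inter : B → B → B
  compl : B → B
  empty : B
  total : B
  union_comm : ∀ a b, union a b = union b a
  inter_comm : ∀ a b, inter a b = inter b a
  union_assoc : ∀ a b c, union a (union b c) = union (union a b) c
  inter_assoc : ∀ a b c, inter a (inter b c) = inter (inter a b) c
  inter_union : ∀ a b c, inter a (union b c) = union (inter a b) (inter a c)
  union_inter : ∀ a b c, union a (inter b c) = inter (union a b) (union a c)
  union_empty : ∀ a, union a empty = a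
  inter_total : ∀ a, inter a total = a
  union_compl : ∀ a, union a (compl a) = total
  inter_compl : ∀ a, inter a (compl a) = empty
  union_absorb : ∀ a b, union a (inter a b) = a
  inter_absorb : ∀ a b, inter a (union a b) = a

-- A morphism out of `Boole` amounts to a choice of images for the seven generators that satisfies
-- the relations: this is the universal property of the free prop combined with that of a quotient
-- (`freePROP.lift`, `quotientLift`, `hom_ext`). In `End_B` such a choice is two binary operations,
-- a unary one, two constants, and a coproduct `a ↦ (p a, q a)` with `p`, `q` arbitrary; `ev`
-- carries no data because `B⁰` is a point. Evaluated on tuples, the relations become the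
-- elementwise identities `Conditions` (`conditions_iff`).
--
-- The only real point is that the coproduct is forced to be the diagonal. Cocommutativity gives `q
-- = p`, and coassociativity then says that `p` is idempotent. Absorption reads `p x ∩ (p x ∪ y) =
-- x`; its left side depends on `x` only through `p x`, so it is unchanged when `x` is replaced by
-- `p x`. Hence `p x = x` (`Conditions.left_eq_self`). With `p = q = id` the remaining identities
-- are exactly the axioms of a Boolean monoid.

universe w

/-! ### Universal property of the quotient of a prop -/

namespace SetPROP

/-- Composition of morphisms of props. -/
def Morphism.trans {P : SetPROP.{u}} {Q : SetPROP.{v}} {R : SetPROP.{w}} (f : Morphism P Q)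
    (g : Morphism Q R) : Morphism P R where
  map x := g.map (f.map x)
  map_id n := by rw [f.map_id, g.map_id]
  map_comp x y := by rw [f.map_comp, g.map_comp]
  map_tensor x y := by rw [f.map_tensor, g.map_tensor]
  map_swap m n := by rw [f.map_swap, g.map_swap]

/-- The projection of a prop onto its quotient. -/
def quotientMk (P : SetPROP.{u}) (R : ∀ n m, P.Hom n m → P.Hom n m → Prop) :
    Morphism P (P.quotient R) where
  map x := Quotient.mk _ x
  map_id _ := rfl
  map_comp _ _ := rfl
  map_tensor _ _ := rfl
  map_swap _ _ := rfl

/-- Having the same image under `φ` is itself a congruence of props, so it contains the smallest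
congruence generated by `R`. -/
theorem Morphism.map_eq_of_congr {P : SetPROP.{u}} {Q : SetPROP.{v}}
    {R : ∀ n m, P.Hom n m → P.Hom n m → Prop} (φ : Morphism P Q)
    (hφ : ∀ n m f g, R n m f g → φ.map f = φ.map g) {n m : ℕ} {f g : P.Hom n m}
    (h : Congr P R f g) : φ.map f = φ.map g := by
  induction h with
  | of h => exact hφ _ _ _ _ h
  | refl => rfl
  | symm _ ih => exact ih.symm
  | trans _ _ ih ih' => exact ih.trans ih'
  | comp _ _ ih ih' => rw [φ.map_comp, φ.map_comp, ih, ih']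
  | tensor _ _ ih ih' => rw [φ.map_tensor, φ.map_tensor, ih, ih']

/-- A morphism of props which respects the relations descends to the quotient. -/
def quotientLift {P : SetPROP.{u}} {Q : SetPROP.{v}}
    {R : ∀ n m, P.Hom n m → P.Hom n m → Prop} (φ : Morphism P Q)
    (hφ : ∀ n m f g, R n m f g → φ.map f = φ.map g) : Morphism (P.quotient R) Q where
  map := Quotient.lift φ.map fun _ _ h => φ.map_eq_of_congr hφ h
  map_id n := φ.map_id n
  map_comp f g := by
    induction f using Quotient.inductionOn
    induction g using Quotient.inductionOn
    exact φ.map_comp _ _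
  map_tensor f g := by
    induction f using Quotient.inductionOn
    induction g using Quotient.inductionOn
    exact φ.map_tensor _ _
  map_swap m n := φ.map_swap m n

end SetPROP

/-! ### Universal property of the free prop -/

/-- The value of a formal composite in a prop in which the vertices are interpreted. -/
def PropTerm.value {G : ℕ → ℕ → Type u} {Q : SetPROP.{v}}
    (φ : ∀ n m, G n m → Q.Hom n m) : ∀ {n m}, PropTerm G n m → Q.Hom n m
  | _, _, .vertex g => φ _ _ g
  | _, _, .id n => Q.id n
  | _, _, .comp f g => Q.comp (f.value φ) (g.value φ)
  | _, _, .tensor f g => Q.tensor (f.value φ) (g.value φ)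
  | _, _, .swap m n => Q.swap m n

/-- Needed because strict associativity, the unit laws and the hexagon are stated only after
transport along equalities of natural numbers. -/
theorem PropTerm.value_homCast {G : ℕ → ℕ → Type u} {Q : SetPROP.{v}}
    (φ : ∀ n m, G n m → Q.Hom n m) {n n' m m' : ℕ} (hn : n = n') (hm : m = m')
    (f : PropTerm G n m) : (homCast hn hm f).value φ = homCast hn hm (f.value φ) :=
  (homCast_natural (H := PropTerm G) (fun _ _ => PropTerm.value φ) hn hm f).symm

/-- Each constructor of `Rel` is either a rule of congruence, which equality satisfies, or an axiom
of props, which holds in `Q`. -/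
theorem PropTerm.Rel.value_eq {G : ℕ → ℕ → Type u} {Q : SetPROP.{v}}
    (φ : ∀ n m, G n m → Q.Hom n m) {n m : ℕ} {f g : PropTerm G n m} (h : Rel G f g) :
    f.value φ = g.value φ := by
  induction h with
  | refl => rfl
  | symm _ ih => exact ih.symm
  | trans _ _ ih ih' => exact ih.trans ih'
  | comp_congr _ _ ih ih' => simp only [PropTerm.value, ih, ih']
  | tensor_congr _ _ ih ih' => simp only [PropTerm.value, ih, ih']
  | id_comp => exact Q.id_comp _
  | comp_id => exact Q.comp_id _
  | comp_assoc => exact Q.comp_assoc _ _ _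
  | tensor_id => exact Q.tensor_id _ _
  | tensor_comp => exact Q.tensor_comp _ _ _ _
  | tensor_assoc => rw [PropTerm.value_homCast]; exact Q.tensor_assoc _ _ _
  | id_zero_tensor => rw [PropTerm.value_homCast]; exact Q.id_zero_tensor _
  | tensor_id_zero => rw [PropTerm.value_homCast]; exact Q.tensor_id_zero _
  | swap_natural => exact Q.swap_natural _ _
  | swap_swap => exact Q.swap_swap _ _
  | hexagon =>
    simp only [PropTerm.value, PropTerm.value_homCast]
    exact Q.hexagon _ _ _

/-- The morphism from the free prop which extends an interpretation of the vertices. -/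
def freePROP.lift {G : ℕ → ℕ → Type u} {Q : SetPROP.{v}} (φ : ∀ n m, G n m → Q.Hom n m) :
    SetPROP.Morphism (freePROP G) Q where
  map := Quotient.lift (PropTerm.value φ) fun _ _ h => PropTerm.Rel.value_eq φ h
  map_id _ := rfl
  map_comp f g := by
    induction f using Quotient.inductionOn
    induction g using Quotient.inductionOn
    rfl
  map_tensor f g := by
    induction f using Quotient.inductionOn
    induction g using Quotient.inductionOn
    rfl
  map_swap _ _ := rfl

/-- Uniqueness half of the universal property: the morphisms on which `r` and `s` agree are closed
under composition and tensor product and contain identities and symmetries. -/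
theorem freePROP.map_eq {G : ℕ → ℕ → Type u} {Q : SetPROP.{v}}
    {r s : SetPROP.Morphism (freePROP G) Q}
    (h : ∀ n m (g : G n m),
      r.map (Quotient.mk _ (PropTerm.vertex g)) = s.map (Quotient.mk _ (PropTerm.vertex g)))
    {n m : ℕ} (f : (freePROP G).Hom n m) : r.map f = s.map f := by
  induction f using Quotient.inductionOn with
  | h f =>
    induction f with
    | vertex g => exact h _ _ g
    | id n => exact (r.map_id n).trans (s.map_id n).symm
    | comp f g ihf ihg =>
      exact (r.map_comp (Quotient.mk _ f) (Quotient.mk _ g)).trans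
        ((congrArg₂ Q.comp ihf ihg).trans (s.map_comp (Quotient.mk _ f) (Quotient.mk _ g)).symm)
    | tensor f g ihf ihg =>
      exact (r.map_tensor (Quotient.mk _ f) (Quotient.mk _ g)).trans
        ((congrArg₂ Q.tensor ihf ihg).trans
          (s.map_tensor (Quotient.mk _ f) (Quotient.mk _ g)).symm)
    | swap m n => exact (r.map_swap m n).trans (s.map_swap m n).symm

/-! ### Morphisms out of Boole -/

namespace Boole

open SetPROP

/-- A morphism from Boole is determined by its values on the generators. -/
theorem hom_ext {Q : SetPROP.{v}} {r s : Morphism Boole Q}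
    (h : ∀ n m (g : BooleVertex n m), r.map (gen g) = s.map (gen g)) : r = s := by
  have key : ∀ {n m} (f : (freePROP BooleVertex).Hom n m),
      ((quotientMk _ BooleRel).trans r).map f = ((quotientMk _ BooleRel).trans s).map f :=
    freePROP.map_eq h
  ext n m f
  induction f using Quotient.inductionOn with
  | h f => exact key f

/-- Lets `r` be computed on composite morphisms, such as the two sides of a relation, from its
values on generators. -/
theorem map_mk_eq_lift {Q : SetPROP.{v}} (r : Morphism Boole Q)
    {φ : ∀ n m, BooleVertex n m → Q.Hom n m} (h : ∀ n m g, r.map (gen g) = φ n m g) {n m : ℕ}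
    (f : (freePROP BooleVertex).Hom n m) :
    r.map ((quotientMk _ BooleRel).map f) = (freePROP.lift φ).map f :=
  freePROP.map_eq (r := (quotientMk _ BooleRel).trans r) (s := freePROP.lift φ) h f

/-! ### The relations as elementwise identities -/

/-- Maps between powers of `B` interpreting the generators of Boole; the coproduct is
interpreted by `a ↦ (p a, q a)`. -/
def interp {B : Type u} (un it : B → B → B) (c p q : B → B) (e t : B) :
    ∀ n m, BooleVertex n m → (endo B).Hom n m
  | _, _, .union => fun x => ![un (x 0) (x 1)]
  | _, _, .inter => fun x => ![it (x 0) (x 1)]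
  | _, _, .compl => fun x => ![c (x 0)]
  | _, _, .coprod => fun x => ![p (x 0), q (x 0)]
  | _, _, .empty => fun _ => ![e]
  | _, _, .total => fun _ => ![t]
  | _, _, .eval => fun _ => ![]

/-- The conditions which the relations of Boole impose on an interpretation. -/
structure Conditions {B : Type u} (un it : B → B → B) (c p q : B → B) (e t : B) : Prop where
  union_comm : ∀ x y, un x y = un y x
  inter_comm : ∀ x y, it x y = it y x
  union_assoc : ∀ x y z, un (un x y) z = un x (un y z)
  inter_assoc : ∀ x y z, it (it x y) z = it x (it y z)
  inter_union : ∀ x y z, it x (un y z) = un (it (p x) y) (it (q x) z)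
  union_inter : ∀ x y z, un x (it y z) = it (un (p x) y) (un (q x) z)
  union_empty : ∀ x, un x e = x
  inter_total : ∀ x, it x t = x
  inter_compl : ∀ x, it (p x) (c (q x)) = e
  union_compl : ∀ x, un (p x) (c (q x)) = t
  inter_absorb : ∀ x y, it (p x) (un (q x) y) = x
  union_absorb : ∀ x y, un (p x) (it (q x) y) = x
  coassoc : ∀ x, p (p x) = p x ∧ q (p x) = p (q x) ∧ q x = q (q x)
  cocomm : ∀ x, q x = p x

theorem forall_fin_one {B : Type u} {C : (Fin 1 → B) → Prop} :
    (∀ x, C x) ↔ ∀ a, C ![a] :=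
  ⟨fun h a => h _, fun h x => by
    have := h (x 0)
    rwa [show ![x 0] = x from by ext i; fin_cases i; rfl] at this⟩

theorem forall_fin_two {B : Type u} {C : (Fin 2 → B) → Prop} :
    (∀ x, C x) ↔ ∀ a b, C ![a, b] :=
  ⟨fun h a b => h _, fun h x => by
    have := h (x 0) (x 1)
    rwa [show ![x 0, x 1] = x from by ext i; fin_cases i <;> rfl] at this⟩

theorem forall_fin_three {B : Type u} {C : (Fin 3 → B) → Prop} :
    (∀ x, C x) ↔ ∀ a b c, C ![a, b, c] :=
  ⟨fun h a b c => h _, fun h x => by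
    have := h (x 0) (x 1) (x 2)
    rwa [show ![x 0, x 1, x 2] = x from by ext i; fin_cases i <;> rfl] at this⟩

/-- At an explicit tuple `![x, y, …]` both sides of a relation compute by definition, and each
coordinate of the resulting equality is one of the conditions. -/
theorem conditions_iff {B : Type u} (un it : B → B → B) (c p q : B → B) (e t : B) :
    (∀ n m f g, BooleRel n m f g →
      (freePROP.lift (interp un it c p q e t)).map f =
        (freePROP.lift (interp un it c p q e t)).map g) ↔ Conditions un it c p q e t := by
  constructor
  · intro h
    refine ⟨fun x y => ?_, fun x y => ?_, fun x y z => ?_, fun x y z => ?_, fun x y z => ?_,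
      fun x y z => ?_, fun x => ?_, fun x => ?_, fun x => ?_, fun x => ?_, fun x y => ?_,
      fun x y => ?_, fun x => ⟨?_, ?_, ?_⟩, fun x => ?_⟩
    · exact congrFun (congrFun (h _ _ _ _ .union_comm) ![x, y]) 0
    · exact congrFun (congrFun (h _ _ _ _ .inter_comm) ![x, y]) 0
    · exact congrFun (congrFun (h _ _ _ _ .union_assoc) ![x, y, z]) 0
    · exact congrFun (congrFun (h _ _ _ _ .inter_assoc) ![x, y, z]) 0
    · exact congrFun (congrFun (h _ _ _ _ .inter_union_distrib) ![x, y, z]) 0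
    · exact congrFun (congrFun (h _ _ _ _ .union_inter_distrib) ![x, y, z]) 0
    · exact congrFun (congrFun (h _ _ _ _ .union_empty) ![x]) 0
    · exact congrFun (congrFun (h _ _ _ _ .inter_total) ![x]) 0
    · exact congrFun (congrFun (h _ _ _ _ .inter_compl) ![x]) 0
    · exact congrFun (congrFun (h _ _ _ _ .union_compl) ![x]) 0
    · exact congrFun (congrFun (h _ _ _ _ .inter_absorb) ![x, y]) 0
    · exact congrFun (congrFun (h _ _ _ _ .union_absorb) ![x, y]) 0
    · exact congrFun (congrFun (h _ _ _ _ .coassoc) ![x]) 0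
    · exact congrFun (congrFun (h _ _ _ _ .coassoc) ![x]) 1
    · exact congrFun (congrFun (h _ _ _ _ .coassoc) ![x]) 2
    · exact congrFun (congrFun (h _ _ _ _ .cocomm) ![x]) 0
  · rintro h _ _ _ _ (_ | _)
    · exact funext (forall_fin_two.2 fun x y => funext (Fin.forall_fin_one.2 (h.union_comm x y)))
    · exact funext (forall_fin_two.2 fun x y => funext (Fin.forall_fin_one.2 (h.inter_comm x y)))
    · exact funext (forall_fin_three.2 fun x y z =>
        funext (Fin.forall_fin_one.2 (h.union_assoc x y z)))
    · exact funext (forall_fin_three.2 fun x y z =>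
        funext (Fin.forall_fin_one.2 (h.inter_assoc x y z)))
    · exact funext (forall_fin_three.2 fun x y z =>
        funext (Fin.forall_fin_one.2 (h.inter_union x y z)))
    · exact funext (forall_fin_three.2 fun x y z =>
        funext (Fin.forall_fin_one.2 (h.union_inter x y z)))
    · exact funext (forall_fin_one.2 fun x => funext (Fin.forall_fin_one.2 (h.union_empty x)))
    · exact funext (forall_fin_one.2 fun x => funext (Fin.forall_fin_one.2 (h.inter_total x)))
    · exact funext (forall_fin_one.2 fun x => funext (Fin.forall_fin_one.2 (h.inter_compl x)))
    · exact funext (forall_fin_one.2 fun x => funext (Fin.forall_fin_one.2 (h.union_compl x)))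
    · exact funext (forall_fin_two.2 fun x y => funext (Fin.forall_fin_one.2 (h.inter_absorb x y)))
    · exact funext (forall_fin_two.2 fun x y => funext (Fin.forall_fin_one.2 (h.union_absorb x y)))
    · refine funext (forall_fin_one.2 fun x => funext fun i => ?_)
      fin_cases i
      exacts [(h.coassoc x).1, (h.coassoc x).2.1, (h.coassoc x).2.2]
    -- Cocommutativity says `(q x, p x) = (p x, q x)`, so its two coordinates are the same equation
    -- read in opposite directions.
    · exact funext (forall_fin_one.2 fun x => funext (Fin.forall_fin_two.2
        ⟨h.cocomm x, (h.cocomm x).symm⟩))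

/-! ### The coproduct is the diagonal -/

theorem Conditions.left_eq_self {B : Type u} {un it : B → B → B} {c p q : B → B} {e t : B}
    (h : Conditions un it c p q e t) (x : B) : p x = x := by
  -- Absorption is used at `p x` and at `x` with the same second argument. Once `q` is replaced by
  -- `p` and `p (p x)` by `p x`, both left sides are `it (p x) (un (p x) x)`, while the right sides
  -- are `p x` and `x`.
  have h₁ := h.inter_absorb (p x) x
  rw [h.cocomm, (h.coassoc x).1] at h₁
  have h₂ := h.inter_absorb x x
  rw [h.cocomm] at h₂
  exact h₁.symm.trans h₂

theorem Conditions.right_eq_self {B : Type u} {un it : B → B → B} {c p q : B → B} {e t : B}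
    (h : Conditions un it c p q e t) (x : B) : q x = x :=
  (h.cocomm x).trans (h.left_eq_self x)

theorem Conditions.diagonal {B : Type u} {un it : B → B → B} {c p q : B → B} {e t : B}
    (h : Conditions un it c p q e t) : Conditions un it c id id e t := by
  obtain rfl : p = _root_.id := funext h.left_eq_self
  obtain rfl : q = _root_.id := funext h.right_eq_self
  exact h

/-- The Boolean monoid whose operations interpret the generators of Boole. -/
def Conditions.toBooleanMonoid {B : Type u} {un it : B → B → B} {c : B → B} {e t : B}
    (h : Conditions un it c id id e t) : BooleanMonoid B where
  union := un
  inter := it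
  compl := c
  empty := e
  total := t
  union_comm := h.union_comm
  inter_comm := h.inter_comm
  union_assoc x y z := (h.union_assoc x y z).symm
  inter_assoc x y z := (h.inter_assoc x y z).symm
  inter_union := h.inter_union
  union_inter := h.union_inter
  union_empty := h.union_empty
  inter_total := h.inter_total
  union_compl := h.union_compl
  inter_compl := h.inter_compl
  union_absorb := h.union_absorb
  inter_absorb := h.inter_absorb

theorem conditions_of_booleanMonoid {B : Type u} (M : BooleanMonoid B) :
    Conditions M.union M.inter M.compl id id M.empty M.total where
  union_comm := M.union_comm
  inter_comm := M.inter_comm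
  union_assoc x y z := (M.union_assoc x y z).symm
  inter_assoc x y z := (M.inter_assoc x y z).symm
  inter_union := M.inter_union
  union_inter := M.union_inter
  union_empty := M.union_empty
  inter_total := M.inter_total
  union_compl := M.union_compl
  inter_compl := M.inter_compl
  union_absorb := M.union_absorb
  inter_absorb := M.inter_absorb
  coassoc _ := ⟨rfl, rfl, rfl⟩
  cocomm _ := rfl

/-! ### The correspondence with Boolean monoids -/

/-- The Boole-algebra structure defined by a Boolean monoid structure. -/
def algebraOfBooleanMonoid {B : Type u} (M : BooleanMonoid B) : AlgebraOn Boole B :=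
  quotientLift (freePROP.lift _)
    ((conditions_iff _ _ _ _ _ _ _).2 (conditions_of_booleanMonoid M))

/-- A map between powers of `B` is determined by its coordinates on explicit tuples, so every
algebra structure has the form `interp` on generators, before anything is known about its coproduct.
-/
theorem map_gen_eq_interp {B : Type u} (r : AlgebraOn Boole B) {n m : ℕ}
    (g : BooleVertex n m) :
    r.map (gen g) =
      interp (fun x y => r.map (gen .union) ![x, y] 0) (fun x y => r.map (gen .inter) ![x, y] 0)
        (fun x => r.map (gen .compl) ![x] 0) (fun x => r.map (gen .coprod) ![x] 0)
        (fun x => r.map (gen .coprod) ![x] 1) (r.map (gen .empty) ![] 0)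
        (r.map (gen .total) ![] 0) n m g := by
  cases g with
  | union => exact funext (forall_fin_two.2 fun x y => funext (Fin.forall_fin_one.2 rfl))
  | inter => exact funext (forall_fin_two.2 fun x y => funext (Fin.forall_fin_one.2 rfl))
  | compl => exact funext (forall_fin_one.2 fun x => funext (Fin.forall_fin_one.2 rfl))
  | coprod => exact funext (forall_fin_one.2 fun x => funext (Fin.forall_fin_two.2 ⟨rfl, rfl⟩))
  | empty =>
    refine funext fun x => funext (Fin.forall_fin_one.2 ?_)
    -- A point of `B⁰` equals the empty tuple only propositionally, so `rfl` alone does not suffice.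
    rw [Subsingleton.elim x ![]]; rfl
  | total =>
    refine funext fun x => funext (Fin.forall_fin_one.2 ?_)
    rw [Subsingleton.elim x ![]]; rfl
  | eval => exact funext fun x => Subsingleton.elim (α := Fin 0 → B) _ _

/-- The two sides of a relation are already equal in `Boole`, hence have the same image under `r`;
`map_mk_eq_lift` turns this into an equation between values of the interpretation. -/
theorem conditions_of_algebra {B : Type u} (r : AlgebraOn Boole B) :
    Conditions (fun x y => r.map (gen .union) ![x, y] 0)
      (fun x y => r.map (gen .inter) ![x, y] 0)
      (fun x => r.map (gen .compl) ![x] 0) (fun x => r.map (gen .coprod) ![x] 0)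
      (fun x => r.map (gen .coprod) ![x] 1) (r.map (gen .empty) ![] 0)
      (r.map (gen .total) ![] 0) := by
  refine (conditions_iff _ _ _ _ _ _ _).1 fun n m f g h => ?_
  rw [← map_mk_eq_lift r (fun _ _ g => map_gen_eq_interp r g) f,
    ← map_mk_eq_lift r (fun _ _ g => map_gen_eq_interp r g) g]
  exact congrArg r.map (Quotient.sound (Congr.of h))

theorem map_coprod {B : Type u} (r : AlgebraOn Boole B) (a : B) :
    r.map (gen .coprod) ![a] = ![a, a] :=
  funext (Fin.forall_fin_two.2
    ⟨(conditions_of_algebra r).left_eq_self a, (conditions_of_algebra r).right_eq_self a⟩)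

/-- Boole-algebra structures are the same as Boolean monoid structures. -/
def algebraEquiv (B : Type u) : AlgebraOn Boole B ≃ BooleanMonoid B where
  toFun r := (conditions_of_algebra r).diagonal.toBooleanMonoid
  invFun := algebraOfBooleanMonoid
  left_inv r := by
    refine hom_ext fun n m g => ?_
    -- The Boolean monoid forgets the coproduct; since both its components are the identity, nothing
    -- is lost.
    rw [map_gen_eq_interp r g, funext (conditions_of_algebra r).left_eq_self,
      funext (conditions_of_algebra r).right_eq_self]
    rfl
  right_inv _ := rfl

end Boole

theorem mainTheorem3 (B : Type u) :
    ∃ Φ : SetPROP.AlgebraOn Boole B ≃ BooleanMonoid B,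
      ∀ r : SetPROP.AlgebraOn Boole B,
        (∀ a b : B, r.map (Boole.gen .union) ![a, b] = ![(Φ r).union a b]) ∧
        (∀ a b : B, r.map (Boole.gen .inter) ![a, b] = ![(Φ r).inter a b]) ∧
        (∀ a : B, r.map (Boole.gen .compl) ![a] = ![(Φ r).compl a]) ∧
        r.map (Boole.gen .empty) ![] = ![(Φ r).empty] ∧
        r.map (Boole.gen .total) ![] = ![(Φ r).total] ∧
        (∀ a : B, r.map (Boole.gen .coprod) ![a] = ![a, a]) ∧
        (∀ a : B, r.map (Boole.gen .eval) ![a] = ![]) :=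
  ⟨Boole.algebraEquiv B, fun r =>
    ⟨fun a b => congrFun (Boole.map_gen_eq_interp r .union) ![a, b],
      fun a b => congrFun (Boole.map_gen_eq_interp r .inter) ![a, b],
      fun a => congrFun (Boole.map_gen_eq_interp r .compl) ![a],
      congrFun (Boole.map_gen_eq_interp r .empty) ![],
      congrFun (Boole.map_gen_eq_interp r .total) ![],
      Boole.map_coprod r, fun _ => Subsingleton.elim (α := Fin 0 → B) _ _⟩⟩
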